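/- Group testing: among $t$ elements exactly $s$ are defective; a test of a pool (a subset of the elements) is positive iff the pool contains a defective element. Let $N_p(t,s)$ be the minimal worst-case total number of tests needed to find all $s$ defective elements among $t$ elements using at most $p$ stages (tests within a stage are performed in parallel; the tests of a stage may depend on the outcomes of the previous stages), and let $$R_p(s)=\liminf_{t\to\infty}\frac{\log_2 t}{N_p(t,s)}.$$ Let $h(x)=-x\log_2 x-(1-x)\log_2(1-x)$ with $0\log_2 0=0$. For an integer $l\ge 1$, $0<w<1$ and $w<q<lw$, $q\le 1$, put $$A(l,w,q)=(1-q)\log_2(1-q)+q\log_2\frac{wy^l}{1-y}+lw\log_2\frac{1-y}{y}+l\,h(w),$$ where $y\in(0,1)$ is the unique root of $q=w\frac{1-y^l}{1-y}$; at the end points let $A$ be the corresponding limit, i.e. $A(l,w,w)=(l-1)h(w)$ and $A(l,w,lw)=(1-lw)\log_2(1-lw)+lw\log_2 w+l\,h(w)$ if $lw\le 1$. For integers $0\le k<s$ put $$\underline R_1(s,k,w)=\inf_{\max(w,kw/2)\le q\le\min((s-k)w,1)}\frac{A(s-k,w,q)-kw+h(q)}{s-k},$$ $$\underline R_2(s,k,w)=\inf_{\substack{w\le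 q\le 1\\ q\le (s-k)w,\ q\le kw/2}}\frac{A(s-k,w,q)-kw\,h\!\left(\frac{q}{kw}\right)+h(q)}{s-k},$$ where the infimum over an empty set is $+\infty$, and $\underline R(s,k,w)=\min\{\underline R_1(s,k,w),\underline R_2(s,k,w)\}$. Theorem. For every integer $s\ge 1$, $$R_2(s)\ \ge\ \sup_{0<w<1}\ \min_{0\le k<s}\ \underline R(s,k,w).$$ -/

import Mathlib

namespace GroupTesting

/-! ## Group testing strategies -/

/-- The result of the test of the pool `P` when `S` is the set of defective elements: it is
positive exactly when the pool contains a defective element. -/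
def testResult {t : ℕ} (P S : Finset (Fin t)) : Bool := decide (P ∩ S).Nonempty

/-- The vector of results of the tests `pool 0, …, pool (n - 1)`, performed in parallel. -/
def outcome {t n : ℕ} (pool : Fin n → Finset (Fin t)) (S : Finset (Fin t)) : Fin n → Bool :=
  fun i => testResult (pool i) S

/-- A deterministic search strategy with `p` stages for `t` elements. In a stage, `n` pools are
tested in parallel, and the rest of the strategy may depend on all results of that stage (hence on
all results obtained so far). After the last stage the strategy names a set of elements.
A stage may consist of `n = 0` tests, so strategies with fewer stages are included. -/
inductive Strategy (t : ℕ) : ℕ → Type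
  | answer (S : Finset (Fin t)) : Strategy t 0
  | stage {p : ℕ} (n : ℕ) (pool : Fin n → Finset (Fin t))
      (next : (Fin n → Bool) → Strategy t p) : Strategy t (p + 1)

namespace Strategy

/-- The set that the strategy names when the set of defective elements is `S`. -/
def result {t : ℕ} : {p : ℕ} → Strategy t p → Finset (Fin t) → Finset (Fin t)
  | _, answer A, _ => A
  | _, stage _ pool next, S => (next (outcome pool S)).result S

/-- The total number of tests performed when the set of defective elements is `S`. -/
def numTests {t : ℕ} : {p : ℕ} → Strategy t p → Finset (Fin t) → ℕ
  | _, answer _, _ => 0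
  | _, stage n pool next, S => n + (next (outcome pool S)).numTests S

/-- The strategy identifies every set of exactly `s` defective elements. -/
def FindsAll {t p : ℕ} (σ : Strategy t p) (s : ℕ) : Prop :=
  ∀ S : Finset (Fin t), S.card = s → σ.result S = S

end Strategy

/-- `N_p(t, s)`: the minimal worst-case total number of tests needed to find all `s` defective
elements among `t` elements using at most `p` stages. -/
noncomputable def minTests (p t s : ℕ) : ℕ :=
  sInf {N : ℕ | ∃ σ : Strategy t p, σ.FindsAll s ∧
    ∀ S : Finset (Fin t), S.card = s → σ.numTests S ≤ N}

/-- For `p ≥ 1` the set whose infimum defines `minTests` is nonempty: `t` individual tests in the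
first stage suffice. -/
theorem exists_strategy (p t s : ℕ) : ∃ σ : Strategy t (p + 1), σ.FindsAll s ∧
    ∀ S : Finset (Fin t), S.card = s → σ.numTests S ≤ t := by
  have idle : ∀ (p : ℕ) (A : Finset (Fin t)), ∃ σ : Strategy t p,
      ∀ S, σ.result S = A ∧ σ.numTests S = 0 := by
    intro p A
    induction p with
    | zero => exact ⟨.answer A, fun S => ⟨rfl, rfl⟩⟩
    | succ p ih =>
      obtain ⟨σ, hσ⟩ := ih
      exact ⟨.stage 0 (fun i => i.elim0) (fun _ => σ), fun S => by
        simp [Strategy.result, Strategy.numTests, hσ S]⟩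
  choose f hf using idle p
  refine ⟨.stage t (fun i => {i}) (fun y => f (Finset.univ.filter (fun i => y i = true))), ?_, ?_⟩
  · intro S _
    simp only [Strategy.result, (hf _ _).1]
    ext i
    simp only [outcome, testResult, Finset.mem_filter, Finset.mem_univ, true_and, decide_eq_true_eq]
    constructor
    · rintro ⟨j, hj⟩
      simp only [Finset.mem_inter, Finset.mem_singleton] at hj
      exact hj.1 ▸ hj.2
    · intro hi
      exact ⟨i, by simp [hi]⟩
  · intro S _
    simp [Strategy.numTests, (hf _ _).2]

/-- `R_p(s)`: the lower limit of `log₂ t / N_p(t, s)` as `t → ∞`. -/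
noncomputable def rate (p s : ℕ) : EReal :=
  Filter.liminf (fun t : ℕ => ((Real.logb 2 t / minTests p t s : ℝ) : EReal)) Filter.atTop

/-! ## The explicit lower bound -/

/-- The binary entropy function, to base 2. -/
noncomputable def h (x : ℝ) : ℝ := -x * Real.logb 2 x - (1 - x) * Real.logb 2 (1 - x)

/-- For `0 < w` and `w < q < l w` the equation `q = w (1 - y ^ l) / (1 - y)` has exactly one root
`y` in `(0, 1)`. -/
theorem existsUnique_root (l : ℕ) (w q : ℝ) (hw : 0 < w) (h₁ : w < q) (h₂ : q < l * w) :
    ∃! y : ℝ, (0 < y ∧ y < 1) ∧ q = w * ((1 - y ^ l) / (1 - y)) := by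
  have key : ∀ y : ℝ, y < 1 →
      (1 - y ^ l) / (1 - y) = ∑ i ∈ Finset.range l, y ^ i := by
    intro y hy
    rw [div_eq_iff (by linarith)]
    have := geom_sum_mul y l
    linarith
  have hl : 1 < l := by
    by_contra hl
    have : (l : ℝ) ≤ 1 := by exact_mod_cast not_lt.mp hl
    nlinarith
  have mono : ∀ a b : ℝ, 0 ≤ a → a < b →
      ∑ i ∈ Finset.range l, a ^ i < ∑ i ∈ Finset.range l, b ^ i := by
    intro a b ha hab
    refine Finset.sum_lt_sum (fun i _ => pow_le_pow_left₀ ha hab.le i)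
      ⟨1, Finset.mem_range.mpr hl, by simpa using hab⟩
  have hc : ContinuousOn (fun y : ℝ => w * ∑ i ∈ Finset.range l, y ^ i) (Set.Icc 0 1) := by
    fun_prop
  have h0 : ∑ i ∈ Finset.range l, (0 : ℝ) ^ i = 1 := by
    rw [Finset.sum_eq_single 0]
    · simp
    · intro i _ hi
      simp [hi]
    · intro h
      exact absurd (Finset.mem_range.mpr (by omega)) h
  have himg := intermediate_value_Ioo (zero_le_one (α := ℝ)) hc
  have hq : q ∈ Set.Ioo (w * ∑ i ∈ Finset.range l, (0 : ℝ) ^ i)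
      (w * ∑ i ∈ Finset.range l, (1 : ℝ) ^ i) := by
    rw [h0]
    simp only [one_pow, Finset.sum_const, Finset.card_range, nsmul_eq_mul, mul_one, Set.mem_Ioo]
    exact ⟨h₁, by linarith⟩
  obtain ⟨y, ⟨hy0, hy1⟩, hy⟩ := himg hq
  refine ⟨y, ⟨⟨hy0, hy1⟩, by rw [key y hy1]; exact hy.symm⟩, ?_⟩
  rintro z ⟨⟨hz0, hz1⟩, hz⟩
  rw [key z hz1] at hz
  have e : ∑ i ∈ Finset.range l, z ^ i = ∑ i ∈ Finset.range l, y ^ i := by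
    have : w * ∑ i ∈ Finset.range l, z ^ i = w * ∑ i ∈ Finset.range l, y ^ i := by
      rw [← hz]; exact hy.symm
    exact mul_left_cancel₀ hw.ne' this
  rcases lt_trichotomy z y with hlt | heq | hgt
  · exact absurd e (mono z y hz0.le hlt).ne
  · exact heq
  · exact absurd e (mono y z hy0.le hgt).ne'

open Classical in
/-- The root `y ∈ (0, 1)` of `q = w (1 - y ^ l) / (1 - y)` (unique for `w < q < l w`). -/
noncomputable def root (l : ℕ) (w q : ℝ) : ℝ :=
  if H : ∃ y : ℝ, (0 < y ∧ y < 1) ∧ q = w * ((1 - y ^ l) / (1 - y)) then H.choose else 0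

open Real in
/-- The exponent `A(l, w, q)`, for `w ≤ q ≤ min(1, l w)`. The last branch is the formula for
`w < q < l w`; the first two are its limits at the end points `q = w` (where `y → 0`) and
`q = l w` (where `y → 1`). For `l = 1` the only point is `q = w`, with the value `0`. -/
noncomputable def A (l : ℕ) (w q : ℝ) : ℝ :=
  if q ≤ w then (l - 1) * h w
  else if l * w ≤ q then (1 - q) * logb 2 (1 - q) + q * logb 2 w + l * h w
  else
    let y := root l w q
    (1 - q) * logb 2 (1 - q) + q * logb 2 (w * y ^ l / (1 - y))
      + l * w * logb 2 ((1 - y) / y) + l * h w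

/-- `R̲₁(s, k, w)`: the infimum over `max(w, kw/2) ≤ q ≤ min((s - k)w, 1)`
(it is `+∞` if there is no such `q`). -/
noncomputable def lowerRate₁ (s k : ℕ) (w : ℝ) : EReal :=
  ⨅ q ∈ {q : ℝ | max w (k * w / 2) ≤ q ∧ q ≤ min ((s - k) * w) 1},
    (((A (s - k) w q - k * w + h q) / (s - k) : ℝ) : EReal)

/-- `R̲₂(s, k, w)`: the infimum over `w ≤ q ≤ 1`, `q ≤ (s - k)w`, `q ≤ kw/2`
(it is `+∞` if there is no such `q`). -/
noncomputable def lowerRate₂ (s k : ℕ) (w : ℝ) : EReal :=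
  ⨅ q ∈ {q : ℝ | (w ≤ q ∧ q ≤ 1) ∧ q ≤ (s - k) * w ∧ q ≤ k * w / 2},
    (((A (s - k) w q - k * w * h (q / (k * w)) + h q) / (s - k) : ℝ) : EReal)

/-- `R̲(s, k, w)`. -/
noncomputable def lowerRate (s k : ℕ) (w : ℝ) : EReal :=
  min (lowerRate₁ s k w) (lowerRate₂ s k w)

end GroupTesting

/-! The first stage uses a random code: every element receives an independent uniform column of
weight `W`, about `w * N`, among `N` tests, and the outcome is the union of the defective columns.
If an outcome `y` leaves more than `s! * m ^ s` candidate sets, `exists_sunflower` finds among them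
`m` candidates that share a core of `k < s` elements and have disjoint nonempty petals of `l = s -
k` elements. Otherwise few candidates remain, and testing all their elements individually in the
second stage costs a constant (`minTests_two_le`).

Given `y` and the columns of the core, the petals of a sunflower are independent, and each completes
the core to `y` with probability at most about `2 ^ (-N * l * b')` if `b'` lies below the lower
rate. With `t` about `2 ^ (b * N)`, the expected number of bad sunflowers is at most about `t ^ (k +
m * l) * 2 ^ N * 2 ^ (-N * m * l * b')`. The factors `2 ^ N` (choice of `y`) and `t ^ k` (choice of
the core) do not grow with `m`, so for any `b < b'` a large constant `m` makes the expectation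
vanish as `N` grows (`exists_code`, `eventually_sum_expected_lt_one`).

The probability for one petal comes from a generating function (`card_tuples_mul_le`) with two
parameters: `z` fixes the column weights and yields `A`, while `x ≤ 1` fixes the size of the petal's
union, where `x = 1` yields the first lower rate and `x < 1` the second. -/

/-! ### Sunflowers -/

open Finset in
/-- Either a family of sets of size `s` contains `m` pairwise disjoint members, or some set of size
at most `s * m` meets all its members. -/
theorem Finset.exists_pairwise_disjoint_or_hitting {α : Type*} [DecidableEq α] {s : ℕ}
    (F : Finset (Finset α)) (hF : ∀ A ∈ F, #A = s) (m : ℕ) :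
    (∃ P : Fin m → Finset α, Pairwise (Function.onFun Disjoint P) ∧ ∀ i, P i ∈ F) ∨
      ∃ X : Finset α, #X ≤ s * m ∧ ∀ A ∈ F, ¬ Disjoint A X := by
  induction m with
  | zero => exact Or.inl ⟨Fin.elim0, fun i => i.elim0, fun i => i.elim0⟩
  | succ m ih =>
    rcases ih with ⟨P, hP, hPF⟩ | ⟨X, hX, hXF⟩
    · by_cases hA : ∀ A ∈ F, ¬ Disjoint A (univ.biUnion P)
      · refine Or.inr ⟨_, ?_, hA⟩
        calc #(univ.biUnion P) ≤ ∑ i, #(P i) := card_biUnion_le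
          _ = s * m := by simp [fun i => hF _ (hPF i), mul_comm]
          _ ≤ s * (m + 1) := by gcongr; omega
      · push Not at hA
        obtain ⟨A, hAF, hA⟩ := hA
        rw [disjoint_biUnion_right] at hA
        refine Or.inl ⟨Fin.cons A P, ?_, ?_⟩
        · intro i j
          refine Fin.cases ?_ (fun i => ?_) i <;> refine Fin.cases ?_ (fun j => ?_) j
          · simp
          · intro _
            simpa [Function.onFun] using hA j (mem_univ _)
          · intro _
            simpa [Function.onFun] using (hA i (mem_univ _)).symm
          · intro hij
            have : i ≠ j := fun h => hij (by rw [h])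
            simpa [Function.onFun] using hP this
        · intro i
          refine Fin.cases ?_ (fun i => ?_) i <;> simp [hAF, hPF]
    · exact Or.inr ⟨X, hX.trans (by gcongr; omega), hXF⟩

open Finset in
/-- The Erdős–Rado sunflower lemma. -/
theorem Finset.exists_sunflower {α : Type*} [DecidableEq α] (m s : ℕ) (F : Finset (Finset α))
    (hF : ∀ A ∈ F, #A = s) (hc : s.factorial * m ^ s < #F) :
    ∃ (K : Finset α) (P : Fin m → Finset α), (∀ i, (P i).Nonempty) ∧ (∀ i, Disjoint K (P i)) ∧
      Pairwise (Function.onFun Disjoint P) ∧ ∀ i, K ∪ P i ∈ F := by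
  induction s generalizing F with
  | zero =>
    have : F ⊆ {∅} := fun A hA => by simpa using hF A hA
    have := card_le_card this
    simp at this hc
    omega
  | succ s ih =>
    rcases exists_pairwise_disjoint_or_hitting F hF m with ⟨P, hP, hPF⟩ | ⟨X, hX, hXF⟩
    · exact ⟨∅, P, fun i => card_pos.mp (by rw [hF _ (hPF i)]; omega), by simp, hP,
        by simpa using hPF⟩
    -- Pigeonhole over the at most `(s + 1) * m` points of the hitting set; the popular point joins
    -- the core.
    · obtain ⟨x, hxX, hx⟩ : ∃ x ∈ X, s.factorial * m ^ s < #{A ∈ F | x ∈ A} := by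
        by_contra! hcon
        have hsub : F ⊆ X.biUnion fun x => {A ∈ F | x ∈ A} := by
          intro A hA
          obtain ⟨x, hxA, hxX⟩ := not_disjoint_iff.mp (hXF A hA)
          simp only [mem_biUnion, mem_filter]
          exact ⟨x, hxX, hA, hxA⟩
        have h1 := (card_le_card hsub).trans (card_biUnion_le_card_mul _ _ _ hcon)
        have h2 : #X * (s.factorial * m ^ s) ≤ (s + 1).factorial * m ^ (s + 1) := by
          calc _ ≤ (s + 1) * m * (s.factorial * m ^ s) := by gcongr
            _ = _ := by rw [Nat.factorial_succ, pow_succ]; ring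
        omega
      have hinj : Set.InjOn (fun A : Finset α => A.erase x) ({A ∈ F | x ∈ A} : Finset _) := by
        intro A hA B hB hAB
        simp only [coe_filter, Set.mem_ofPred_eq] at hA hB
        rw [← insert_erase hA.2, ← insert_erase hB.2]
        exact congrArg (insert x) hAB
      obtain ⟨K, P, hne, hKP, hP, hU⟩ := ih ({A ∈ F | x ∈ A}.image fun A => A.erase x)
        (by
          intro B hB
          simp only [mem_image, mem_filter] at hB
          obtain ⟨A, ⟨hA, hxA⟩, rfl⟩ := hB
          rw [card_erase_of_mem hxA, hF A hA]; rfl)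
        (by rwa [card_image_of_injOn hinj])
      have hU' : ∀ i, x ∉ K ∪ P i ∧ insert x (K ∪ P i) ∈ F := by
        intro i
        have := hU i
        simp only [mem_image, mem_filter] at this
        obtain ⟨A, ⟨hA, hxA⟩, h⟩ := this
        rw [← h, insert_erase hxA]
        exact ⟨by simp, hA⟩
      refine ⟨insert x K, P, hne, fun i => ?_, hP, fun i => ?_⟩
      · rw [disjoint_insert_left]
        exact ⟨fun h => (hU' i).1 (mem_union_right _ h), hKP i⟩
      · rw [insert_union]
        exact (hU' i).2

/-! ### Two-stage strategies -/

namespace GroupTesting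

open Finset

/-- The strategy that tests the elements of `V` individually. -/
noncomputable def Strategy.individual {t : ℕ} (V : Finset (Fin t)) : Strategy t 1 :=
  .stage #V (fun i => {(V.equivFin.symm i : Fin t)})
    (fun z => .answer {j | ∃ i, (V.equivFin.symm i : Fin t) = j ∧ z i = true})

theorem Strategy.individual_result {t : ℕ} {V S : Finset (Fin t)} (hS : S ⊆ V) :
    (Strategy.individual V).result S = S := by
  ext j
  simp only [individual, result, mem_filter, mem_univ, true_and, outcome, testResult,
    decide_eq_true_eq]
  constructor
  · rintro ⟨i, rfl, x, hx⟩
    simp only [mem_inter, mem_singleton] at hx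
    exact hx.1 ▸ hx.2
  · intro hj
    refine ⟨V.equivFin ⟨j, hS hj⟩, by simp, j, by simp [hj]⟩

theorem Strategy.individual_numTests {t : ℕ} (V S : Finset (Fin t)) :
    (Strategy.individual V).numTests S = #V := by
  simp [individual, numTests]

/-- If in the first stage every outcome leaves at most `C` candidates, then `N + s * C` tests in two
stages suffice. Element `j` is in the pools indexed by `c j`. -/
theorem minTests_two_le {t s N C : ℕ} (c : Fin t → Finset (Fin N))
    (hc : ∀ y, #{S ∈ powersetCard s (univ : Finset (Fin t)) | S.biUnion c = y} ≤ C) :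
    minTests 2 t s ≤ N + s * C := by
  let F : Finset (Fin N) → Finset (Finset (Fin t)) := fun y =>
    {S ∈ powersetCard s (univ : Finset (Fin t)) | S.biUnion c = y}
  let pool : Fin N → Finset (Fin t) := fun i => {j | i ∈ c j}
  let σ : Strategy t 2 := .stage N pool
    fun z => Strategy.individual ((F {i | z i = true}).biUnion id)
  have hout : ∀ S : Finset (Fin t), ({i | outcome pool S i = true} : Finset (Fin N)) =
      S.biUnion c := by
    intro S
    ext i
    simp only [outcome, testResult, pool, mem_filter, mem_univ, true_and, decide_eq_true_eq,
      mem_biUnion, Finset.Nonempty, mem_inter]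
    exact exists_congr fun j => and_comm
  apply Nat.sInf_le
  refine ⟨σ, fun S hS => ?_, fun S hS => ?_⟩
  · simp only [σ, Strategy.result]
    refine Strategy.individual_result ?_
    rw [hout]
    exact subset_biUnion_of_mem (s := F (S.biUnion c)) id (x := S) (by simp [F, hS])
  · simp only [σ, Strategy.numTests, Strategy.individual_numTests, hout]
    gcongr
    rw [mul_comm]
    refine (card_biUnion_le_card_mul _ _ s fun A hA => ?_).trans (Nat.mul_le_mul_right _ (hc _))
    simp only [F, mem_filter, mem_powersetCard] at hA
    exact hA.1.2.le

theorem Strategy.result_eq_of_numTests_eq_zero {t p : ℕ} (σ : Strategy t p) (S T : Finset (Fin t))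
    (hS : σ.numTests S = 0) (hT : σ.numTests T = 0) : σ.result S = σ.result T := by
  induction σ with
  | answer A => rfl
  | stage n pool next ih =>
    simp only [numTests, Nat.add_eq_zero_iff] at hS hT
    obtain ⟨rfl, hS⟩ := hS
    have h : outcome pool S = outcome pool T := Subsingleton.elim _ _
    simp only [result, h]
    exact ih _ (h ▸ hS) hT.2

/-- There are at least two possible defective sets, and without tests they get the same answer. This
excludes division by zero, with its default value `0`, in the rate. -/
theorem minTests_pos {p t s : ℕ} (hs : 1 ≤ s) (hst : s < t) : 0 < minTests (p + 1) t s := by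
  by_contra! h0
  have hmem := Nat.sInf_mem (s := {N : ℕ | ∃ σ : Strategy t (p + 1), σ.FindsAll s ∧
    ∀ S : Finset (Fin t), S.card = s → σ.numTests S ≤ N}) ⟨t, exists_strategy p t s⟩
  obtain ⟨σ, hσ, hN⟩ := hmem
  change ∀ S : Finset (Fin t), #S = s → σ.numTests S ≤ minTests (p + 1) t s at hN
  have hcard : 1 < #(powersetCard s (univ : Finset (Fin t))) := by
    rw [card_powersetCard, card_univ, Fintype.card_fin]
    have := Nat.choose_le_choose s (show s + 1 ≤ t from hst)
    rw [Nat.choose_succ_self_right] at this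
    omega
  obtain ⟨S, hS, T, hT, hne⟩ := one_lt_card.mp hcard
  simp only [mem_powersetCard, subset_univ, true_and] at hS hT
  refine hne ?_
  rw [← hσ S hS, ← hσ T hT]
  exact σ.result_eq_of_numTests_eq_zero S T (by have := hN S hS; omega)
    (by have := hN T hT; omega)

end GroupTesting

/-! ### Generating function bound and binomial coefficients -/

namespace GroupTesting

open Finset

theorem sum_nonempty_pow_card (l : ℕ) (z : ℝ) :
    ∑ D : Finset (Fin l) with D.Nonempty, z ^ #D = (1 + z) ^ l - 1 := by
  have h1 : ∑ D : Finset (Fin l), z ^ #D = (1 + z) ^ l := by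
    have := Fin.sum_pow_mul_eq_add_pow (n := l) z 1
    simpa [add_comm] using this
  have h2 := sum_filter_add_sum_filter_not (univ : Finset (Finset (Fin l)))
    (fun D => D.Nonempty) (fun D => z ^ #D)
  have h3 : ({D : Finset (Fin l) | ¬ D.Nonempty} : Finset _) = {∅} := by
    ext D; simp
  rw [h3, h1] at h2
  simp at h2
  linarith

/-- Chernoff-type bound for the number of `l`-tuples of `W`-sets whose union has `Q` elements and
completes `u` to `y`. -/
theorem card_tuples_mul_le {l N : ℕ} (W Q : ℕ) (hl : 1 ≤ l) (u y : Finset (Fin N)) {z x : ℝ}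
    (hz : 0 < z) (hx : 0 < x) (hx1 : x ≤ 1) :
    (#{c : Fin l → Finset (Fin N) | (∀ i, #(c i) = W) ∧ #(univ.biUnion c) = Q ∧
      u ∪ univ.biUnion c = y} : ℝ) * (z ^ (l * W) * (x / ((1 + z) ^ l - 1)) ^ Q) ≤
      (1 + x) ^ #u := by
  classical
  set g := (1 + z) ^ l - 1 with hgdef
  have hg : 0 < g := sub_pos.mpr (one_lt_pow₀ (by linarith) (by omega))
  -- Weight of `D` as the set of columns that contain the coordinate `a`. Division by `g` makes the
  -- nonempty `D` contribute `x` in total, so a coordinate sums to at most `1 + x` in `u`, to `x ≤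
  -- 1` in `y \ u`, and to at most `1` outside `y`.
  let f : Fin N → Finset (Fin l) → ℝ := fun a D =>
    if (a ∉ u ∧ a ∈ y → D.Nonempty) ∧ (a ∉ y → D = ∅) then
      z ^ #D * (if D.Nonempty then x / g else 1) else 0
  have hf0 : ∀ a D, 0 ≤ f a D := by
    intro a D
    simp only [f]
    split_ifs <;> positivity
  have hsum : ∀ a, ∑ D, f a D ≤ if a ∈ u then 1 + x else 1 := by
    intro a
    have hne : ∑ D : Finset (Fin l), (if D.Nonempty then z ^ #D * (x / g) else 0) = x := by
      rw [← sum_filter, ← sum_mul, sum_nonempty_pow_card, ← hgdef]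
      field_simp
    have hem : ∑ D : Finset (Fin l), (if D = ∅ then (1 : ℝ) else 0) = 1 := by simp
    by_cases hau : a ∈ u
    · rw [if_pos hau]
      calc ∑ D, f a D ≤ ∑ D : Finset (Fin l), ((if D = ∅ then (1 : ℝ) else 0) +
            (if D.Nonempty then z ^ #D * (x / g) else 0)) := by
            refine sum_le_sum fun D _ => ?_
            rcases D.eq_empty_or_nonempty with rfl | hD
            · simp only [f]; split_ifs <;> simp_all
            · have := hD.ne_empty
              have h0 : 0 ≤ z ^ #D * (x / g) := by positivity
              simp only [f]; split_ifs <;> simp_all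
        _ = 1 + x := by rw [sum_add_distrib, hne, hem]
    · rw [if_neg hau]
      by_cases hay : a ∈ y
      · calc ∑ D, f a D = ∑ D : Finset (Fin l), (if D.Nonempty then z ^ #D * (x / g) else 0) := by
              refine sum_congr rfl fun D _ => ?_
              simp only [f]; split_ifs <;> simp_all
          _ ≤ 1 := by rw [hne]; exact hx1
      · calc ∑ D, f a D = ∑ D : Finset (Fin l), (if D = ∅ then (1 : ℝ) else 0) := by
              refine sum_congr rfl fun D _ => ?_
              simp only [f]; split_ifs <;> simp_all
          _ ≤ 1 := hem.le
  -- Reading the incidence matrix by rows turns the sum over tuples into a product over coordinates.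
  let tr : (Fin l → Finset (Fin N)) → Fin N → Finset (Fin l) := fun c a => {i | a ∈ c i}
  have htr : Function.Injective tr := by
    intro c d h
    funext i
    ext a
    have := congrArg (i ∈ ·) (congrFun h a)
    simpa [tr] using this
  have hval : ∀ c ∈ ({c : Fin l → Finset (Fin N) | (∀ i, #(c i) = W) ∧ #(univ.biUnion c) = Q ∧
      u ∪ univ.biUnion c = y} : Finset _), z ^ (l * W) * (x / g) ^ Q = ∏ a, f a (tr c a) := by
    intro c hc
    simp only [mem_filter, mem_univ, true_and] at hc
    obtain ⟨hW, hQ, hy⟩ := hc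
    have hmem : ∀ a, (tr c a).Nonempty ↔ a ∈ univ.biUnion c := by
      intro a
      simp [tr, Finset.Nonempty]
    have h1 : ∀ a, f a (tr c a) = z ^ #(tr c a) * (if a ∈ univ.biUnion c then x / g else 1) := by
      intro a
      simp only [f, hmem]
      rw [if_pos]
      subst hy
      refine ⟨fun ⟨h1, h2⟩ => (mem_union.mp h2).resolve_left h1, fun h => ?_⟩
      rw [← not_nonempty_iff_eq_empty, hmem]
      exact fun h' => h (mem_union_right _ h')
    have h2 : ∑ a, #(tr c a) = l * W := by
      have : ∑ a, #(tr c a) = ∑ i, #(c i) := by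
        have := sum_card_bipartiteAbove_eq_sum_card_bipartiteBelow (s := (univ : Finset (Fin N)))
          (t := (univ : Finset (Fin l))) (fun a i => a ∈ c i)
        simpa [bipartiteAbove, bipartiteBelow, tr] using this
      rw [this]
      simp [hW]
    simp only [h1]
    rw [prod_mul_distrib, prod_pow_eq_pow_sum, h2, prod_ite, prod_const, prod_const_one, mul_one,
      filter_mem_eq_inter, univ_inter, hQ]
  rw [← nsmul_eq_mul, ← sum_const, sum_congr rfl hval]
  calc _ ≤ ∑ d : Fin N → Finset (Fin l), ∏ a, f a (d a) := by
        rw [← sum_image (f := fun d => ∏ a, f a (d a)) htr.injOn]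
        exact sum_le_sum_of_subset_of_nonneg (subset_univ _)
          fun d _ _ => prod_nonneg fun a _ => hf0 _ _
    _ = ∏ a, ∑ D, f a D := by
        rw [prod_univ_sum, Fintype.piFinset_univ]
    _ ≤ ∏ a, (if a ∈ u then 1 + x else 1) :=
        prod_le_prod (fun a _ => sum_nonneg fun D _ => hf0 _ _) fun a _ => hsum a
    _ = (1 + x) ^ #u := by
        rw [prod_ite, prod_const, prod_const_one, mul_one, filter_mem_eq_inter, univ_inter]

/-- As a function of `j`, `W ^ j / j!` is maximal at `j = W`. Hence `j = W` is the largest term in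
the binomial expansion of `(W + V) ^ (W + V)`. -/
theorem factorial_mul_pow_le_mul_factorial (W j : ℕ) :
    W.factorial * W ^ j ≤ W ^ W * j.factorial := by
  rcases le_total W j with h | h
  · calc W.factorial * W ^ j = W ^ W * (W.factorial * W ^ (j - W)) := by
          rw [← Nat.add_sub_cancel' h, pow_add]
          simp only [Nat.add_sub_cancel_left]
          ring
      _ ≤ W ^ W * j.factorial := by
          gcongr; exact Nat.factorial_mul_pow_sub_le_factorial h
  · calc W.factorial * W ^ j ≤ (j.factorial * W ^ (W - j)) * W ^ j := by
          gcongr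
          obtain ⟨d, rfl⟩ := Nat.exists_eq_add_of_le h
          rw [Nat.add_sub_cancel_left]
          calc (j + d).factorial = j.factorial * (j + 1).ascFactorial d :=
                (Nat.factorial_mul_ascFactorial j d).symm
            _ ≤ j.factorial * (j + d) ^ d := by
                gcongr; exact Nat.ascFactorial_le_pow_add j d
      _ = W ^ W * j.factorial := by
          rw [mul_assoc, ← pow_add, Nat.sub_add_cancel h, mul_comm]

/-- The entropy lower bound for binomial coefficients. -/
theorem pow_add_le_mul_choose (W V : ℕ) :
    (W + V) ^ (W + V) ≤ (W + V + 1) * ((W + V).choose W * (W ^ W * V ^ V)) := by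
  rw [add_pow]
  refine (sum_le_card_nsmul _ _ ((W + V).choose W * (W ^ W * V ^ V)) fun j hj => ?_).trans
    (by simp)
  have hj : j ≤ W + V := by simpa [Nat.lt_succ_iff] using hj
  obtain ⟨i, hi⟩ := Nat.exists_eq_add_of_le hj
  have hpos : 0 < W.factorial * V.factorial * (j.factorial * i.factorial) := by positivity
  have e : W + V - j = i := by omega
  rw [e]
  refine Nat.le_of_mul_le_mul_right ?_ hpos
  have c1 : (W + V).choose j * (j.factorial * i.factorial) = (W + V).factorial := by
    rw [← e, ← mul_assoc, Nat.choose_mul_factorial_mul_factorial hj]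
  have c2 : (W + V).choose W * (W.factorial * V.factorial) = (W + V).factorial := by
    have := Nat.choose_mul_factorial_mul_factorial (show W ≤ W + V by omega)
    rw [Nat.add_sub_cancel_left] at this
    rw [← mul_assoc, this]
  calc W ^ j * V ^ i * (W + V).choose j * (W.factorial * V.factorial * (j.factorial * i.factorial))
      = ((W + V).choose j * (j.factorial * i.factorial)) *
          ((W.factorial * W ^ j) * (V.factorial * V ^ i)) := by ring
    _ ≤ (W + V).factorial * ((W ^ W * j.factorial) * (V ^ V * i.factorial)) := by
        rw [c1]
        exact Nat.mul_le_mul_left _ (Nat.mul_le_mul (factorial_mul_pow_le_mul_factorial W j)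
          (factorial_mul_pow_le_mul_factorial V i))
    _ = _ := by rw [← c2]; ring

theorem two_rpow_logb {x : ℝ} (hx : 0 < x) : (2 : ℝ) ^ Real.logb 2 x = x :=
  Real.rpow_logb (by norm_num) (by norm_num) hx

theorem two_rpow_mul_h_le {N W : ℕ} (hW : 0 < W) (hWN : W < N) :
    (2 : ℝ) ^ ((N : ℝ) * h (W / N)) ≤ (N + 1) * N.choose W := by
  obtain ⟨V, rfl⟩ := Nat.exists_eq_add_of_lt hWN
  rw [add_assoc]
  set U := V + 1 with hU
  have hW' : (0 : ℝ) < W := by exact_mod_cast hW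
  have hU' : (0 : ℝ) < U := by exact_mod_cast Nat.succ_pos V
  have key : (2 : ℝ) ^ (((W + U : ℕ) : ℝ) * h (W / (W + U : ℕ))) * (W ^ W * U ^ U) =
      ((W + U : ℕ) : ℝ) ^ (W + U) := by
    have hN : (0 : ℝ) < W + U := by positivity
    rw [← two_rpow_logb (x := (W : ℝ) ^ W * (U : ℝ) ^ U) (by positivity),
      ← two_rpow_logb (x := ((W + U : ℕ) : ℝ) ^ (W + U)) (by push_cast; positivity),
      ← Real.rpow_add (by norm_num)]
    congr 1
    push_cast
    rw [h, Real.logb_mul (by positivity) (by positivity), Real.logb_pow, Real.logb_pow,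
      Real.logb_pow, show 1 - (W : ℝ) / (W + U) = U / (W + U) by field_simp; ring,
      Real.logb_div (by positivity) (by positivity), Real.logb_div (by positivity) (by positivity)]
    push_cast
    field_simp
    ring
  have hpos : (0 : ℝ) < W ^ W * U ^ U := by positivity
  rw [← mul_le_mul_iff_left₀ hpos, key]
  have := pow_add_le_mul_choose W U
  rw [mul_assoc]
  exact_mod_cast this

end GroupTesting

/-! ### Random constant-weight codes without bad sunflowers -/

open Finset in
/-- A uniformly random function restricts to a uniformly random function along an embedding. -/
theorem Fintype.card_comp_mem_mul {ι κ Ω : Type*} [Fintype ι] [Fintype κ] [Fintype Ω]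
    [DecidableEq ι] [DecidableEq κ] [DecidableEq Ω] (e : κ ↪ ι) (B : Finset (κ → Ω)) :
    #{f : ι → Ω | f ∘ e ∈ B} * card Ω ^ card κ = #B * card Ω ^ card ι := by
  classical
  let E : (ι → Ω) ≃ (κ → Ω) × ({i // i ∉ Set.range e} → Ω) :=
    (Equiv.piEquivPiSubtypeProd (· ∈ Set.range e) fun _ => Ω).trans
      (Equiv.prodCongr (Equiv.arrowCongr (Equiv.ofInjective e e.injective).symm (Equiv.refl Ω))
        (Equiv.refl _))
  have hE : ∀ f, (E f).1 = f ∘ e := fun f => rfl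
  have h1 : #{f : ι → Ω | f ∘ e ∈ B} = #B * card ({i // i ∉ Set.range e} → Ω) := by
    rw [← card_univ (α := {i // i ∉ Set.range e} → Ω), ← card_product]
    refine Finset.card_equiv E fun f => ?_
    simp [hE]
  have h2 : card (ι → Ω) = card (κ → Ω) * card ({i // i ∉ Set.range e} → Ω) := by
    rw [card_congr E, card_prod]
  rw [card_fun, card_fun (α := κ)] at h2
  rw [h1, h2]
  ring

namespace GroupTesting

open Finset

/-- The columns of weight `W` and length `N`. -/
abbrev Column (N W : ℕ) : Type := {A : Finset (Fin N) // #A = W}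

theorem card_column (N W : ℕ) : Fintype.card (Column N W) = N.choose W := by
  rw [Fintype.card_subtype]
  have : ({A : Finset (Fin N) | #A = W} : Finset _) = powersetCard W univ := by
    ext A; simp
  rw [this, card_powersetCard, card_univ, Fintype.card_fin]

/-- The union of a family of columns. -/
def columnUnion {ι : Type*} [Fintype ι] {N W : ℕ} (d : ι → Column N W) : Finset (Fin N) :=
  univ.biUnion fun i => (d i).1

theorem card_columnUnion_le {ι : Type*} [Fintype ι] {N W : ℕ} (d : ι → Column N W) :
    #(columnUnion d) ≤ Fintype.card ι * W := by
  refine card_biUnion_le_card_mul _ _ _ fun i _ => (d i).2.le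

/-- The assignments of columns to a sunflower with a core of `k` elements and `m` petals of `l`
elements for which all unions of the core with a petal give the same outcome. -/
def badAssignments (N W k m l : ℕ) : Finset (Fin k ⊕ Fin m × Fin l → Column N W) :=
  {g | ∃ y, ∀ i, columnUnion (fun a => g (.inl a)) ∪ columnUnion (fun b => g (.inr (i, b))) = y}

/-- Once the outcome (`2 ^ N` choices) and the core columns are fixed, the petals are chosen
independently, each in at most `D` ways. -/
theorem card_badAssignments_le {N W k l D : ℕ} (m : ℕ)
    (hD : ∀ u y : Finset (Fin N), #u ≤ k * W →
      #{d : Fin l → Column N W | u ∪ columnUnion d = y} ≤ D) :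
    #(badAssignments N W k m l) ≤ 2 ^ N * (N.choose W ^ k * D ^ m) := by
  classical
  let R : (Fin k → Column N W) → Finset (Fin N) → Finset (Fin m → Fin l → Column N W) :=
    fun a y => Fintype.piFinset fun _ => {d | columnUnion a ∪ columnUnion d = y}
  let T : Finset ((_ : Finset (Fin N) × (Fin k → Column N W)) × (Fin m → Fin l → Column N W)) :=
    univ.sigma fun p => R p.2 p.1
  have hT : #T ≤ 2 ^ N * (N.choose W ^ k * D ^ m) := by
    rw [card_sigma]
    calc ∑ p : Finset (Fin N) × (Fin k → Column N W), #(R p.2 p.1)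
        ≤ ∑ p : Finset (Fin N) × (Fin k → Column N W), D ^ m := by
          refine sum_le_sum fun p _ => ?_
          rw [Fintype.card_piFinset, prod_const, card_univ, Fintype.card_fin]
          gcongr
          refine hD _ _ ((card_columnUnion_le _).trans (by simp))
      _ = _ := by
          rw [sum_const, card_univ, Fintype.card_prod, Fintype.card_finset, Fintype.card_fin,
            Fintype.card_fun, card_column, Fintype.card_fin, smul_eq_mul, mul_assoc]
  refine le_trans ?_ hT
  have hex : ∀ g ∈ badAssignments N W k m l, ∃ y, ∀ i,
      columnUnion (fun a => g (.inl a)) ∪ columnUnion (fun b => g (.inr (i, b))) = y := by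
    intro g hg
    simpa [badAssignments] using hg
  choose! Y hY using hex
  refine card_le_card_of_injOn
    (fun g => ⟨(Y g, fun a => g (.inl a)), fun i b => g (.inr (i, b))⟩) ?_ ?_
  · intro g hg
    simp only [T, R, coe_sigma, Set.mem_sigma_iff, mem_coe, mem_univ, true_and,
      Fintype.mem_piFinset, mem_filter]
    exact hY g hg
  · intro g _ g' _ h
    simp only [Sigma.mk.injEq, Prod.mk.injEq, heq_eq_eq] at h
    funext x
    rcases x with a | ⟨i, b⟩
    · exact congrFun h.1.2 a
    · exact congrFun (congrFun h.2 i) b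

/-- A random code avoids all bad sunflowers if the expected number of them is less than one. -/
theorem exists_code {N W t s m : ℕ} (hW : 0 < N.choose W) (r : ℕ → ℝ)
    (hD : ∀ k < s, ∀ u y : Finset (Fin N), #u ≤ k * W →
      (#{d : Fin (s - k) → Column N W | u ∪ columnUnion d = y} : ℝ) ≤
        r k * (N.choose W : ℝ) ^ (s - k))
    (hr0 : ∀ k < s, 0 ≤ r k)
    (hsum : ∑ k ∈ range s, (t : ℝ) ^ (k + m * (s - k)) * (2 ^ N * r k ^ m) < 1) :
    ∃ f : Fin t → Column N W, ∀ k < s, ∀ e : (Fin k ⊕ Fin m × Fin (s - k)) ↪ Fin t,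
      f ∘ e ∉ badAssignments N W k m (s - k) := by
  classical
  by_contra! hcon
  set M := N.choose W with hM
  have hMpos : (0 : ℝ) < M := by exact_mod_cast hW
  let bad : (k : ℕ) → ((Fin k ⊕ Fin m × Fin (s - k)) ↪ Fin t) → Finset (Fin t → Column N W) :=
    fun k e => {f | f ∘ e ∈ badAssignments N W k m (s - k)}
  -- Union bound in counting form: if every code were bad, the bad events would cover all `M ^ t`
  -- codes.
  have hcover : (univ : Finset (Fin t → Column N W)) ⊆
      (range s).biUnion fun k => univ.biUnion (bad k) := by
    intro f _
    obtain ⟨k, hk, e, he⟩ := hcon f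
    simp only [mem_biUnion, mem_range, mem_univ, true_and, bad, mem_filter]
    exact ⟨k, hk, e, he⟩
  have hbad : ∀ k < s, ∀ e, (#(bad k e) : ℝ) ≤ 2 ^ N * r k ^ m * (M : ℝ) ^ t := by
    intro k hk e
    have h1 := Fintype.card_comp_mem_mul e (badAssignments N W k m (s - k))
    simp only [card_column, Fintype.card_sum, Fintype.card_prod, Fintype.card_fin, ← hM] at h1
    have hr : 0 ≤ r k := hr0 k hk
    have h2 := card_badAssignments_le m (D := ⌊r k * (M : ℝ) ^ (s - k)⌋₊)
      fun u y hu => Nat.le_floor (hD k hk u y hu)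
    have h1' : (#(bad k e) : ℝ) * (M : ℝ) ^ (k + m * (s - k)) =
        #(badAssignments N W k m (s - k)) * (M : ℝ) ^ t := by exact_mod_cast h1
    have h2' : (#(badAssignments N W k m (s - k)) : ℝ) ≤
        2 ^ N * ((M : ℝ) ^ k * (⌊r k * (M : ℝ) ^ (s - k)⌋₊ : ℝ) ^ m) := by
      exact_mod_cast h2
    have hpos : (0 : ℝ) < (M : ℝ) ^ (k + m * (s - k)) := by positivity
    rw [← mul_le_mul_iff_left₀ hpos, h1']
    calc _ ≤ 2 ^ N * ((M : ℝ) ^ k * (r k * (M : ℝ) ^ (s - k)) ^ m) * (M : ℝ) ^ t := by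
          refine mul_le_mul_of_nonneg_right (h2'.trans ?_) (by positivity)
          gcongr
          exact Nat.floor_le (by positivity)
      _ = _ := by
          rw [mul_pow, pow_add, ← pow_mul, mul_comm (s - k) m]
          ring
  have hemb : ∀ k, (Fintype.card ((Fin k ⊕ Fin m × Fin (s - k)) ↪ Fin t) : ℝ) ≤
      (t : ℝ) ^ (k + m * (s - k)) := by
    intro k
    have := Fintype.card_le_of_injective (fun (e : (Fin k ⊕ Fin m × Fin (s - k)) ↪ Fin t) => (e : _ → _))
      DFunLike.coe_injective
    simp only [Fintype.card_fun, Fintype.card_sum, Fintype.card_prod, Fintype.card_fin] at this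
    exact_mod_cast this
  have htot : ((M : ℝ) ^ t) ≤
      ∑ k ∈ range s, (t : ℝ) ^ (k + m * (s - k)) * (2 ^ N * r k ^ m) * (M : ℝ) ^ t := by
    calc ((M : ℝ) ^ t) = (#(univ : Finset (Fin t → Column N W)) : ℝ) := by
          rw [card_univ, Fintype.card_fun, card_column, Fintype.card_fin]; push_cast; rfl
      _ ≤ ∑ k ∈ range s, ∑ e, (#(bad k e) : ℝ) := by
          exact_mod_cast (card_le_card hcover).trans (card_biUnion_le.trans
            (sum_le_sum fun k _ => card_biUnion_le))
      _ ≤ _ := by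
          refine sum_le_sum fun k hk => ?_
          have hk := mem_range.mp hk
          have := hr0 k hk
          calc ∑ e, (#(bad k e) : ℝ) ≤ ∑ e : (Fin k ⊕ Fin m × Fin (s - k)) ↪ Fin t,
                2 ^ N * r k ^ m * (M : ℝ) ^ t := sum_le_sum fun e _ => hbad k hk e
            _ = Fintype.card ((Fin k ⊕ Fin m × Fin (s - k)) ↪ Fin t) *
                (2 ^ N * r k ^ m * (M : ℝ) ^ t) := by
                rw [sum_const, card_univ, nsmul_eq_mul]
            _ ≤ (t : ℝ) ^ (k + m * (s - k)) * (2 ^ N * r k ^ m * (M : ℝ) ^ t) := by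
                gcongr
                exact hemb k
            _ = _ := by ring
  rw [← sum_mul] at htot
  have hpos : (0 : ℝ) < (M : ℝ) ^ t := by positivity
  nlinarith

/-- A code without bad sunflowers leaves boundedly many candidates after the first stage. -/
theorem minTests_two_le_of_code {N W t s m : ℕ} (f : Fin t → Column N W)
    (hf : ∀ k < s, ∀ e : (Fin k ⊕ Fin m × Fin (s - k)) ↪ Fin t,
      f ∘ e ∉ badAssignments N W k m (s - k)) (hm : 0 < m) :
    minTests 2 t s ≤ N + s * (s.factorial * m ^ s) := by
  refine minTests_two_le (fun j => (f j).1) fun y => ?_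
  by_contra! hcon
  obtain ⟨K, P, hne, hKP, hP, hU⟩ := exists_sunflower m s _ (fun A hA => by
    simp only [mem_filter, mem_powersetCard] at hA
    exact hA.1.2) hcon
  simp only [mem_filter, mem_powersetCard, subset_univ, true_and] at hU
  have hcard : ∀ i, #K + #(P i) = s := fun i => by
    rw [← card_union_of_disjoint (hKP i)]; exact (hU i).1
  -- A petal exists because `0 < m`, and it is nonempty.
  have hKs : #K < s := by
    have := hcard ⟨0, hm⟩
    have := card_pos.mpr (hne ⟨0, hm⟩)
    omega
  have hPc : ∀ i, #(P i) = s - #K := fun i => by have := hcard i; omega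
  let eK : Fin #K ≃ K := K.equivFin.symm
  let eP : ∀ i, Fin (s - #K) ≃ P i := fun i => (finCongr (hPc i).symm).trans (P i).equivFin.symm
  let e : Fin #K ⊕ Fin m × Fin (s - #K) → Fin t :=
    Sum.elim (fun a => eK a) (fun p => eP p.1 p.2)
  have he : Function.Injective e := by
    rintro (a | ⟨i, b⟩) (a' | ⟨i', b'⟩) h
    · simpa [e, Subtype.coe_inj] using h
    · simp only [e, Sum.elim_inl, Sum.elim_inr] at h
      exact absurd (h ▸ (eP i' b').2) (disjoint_left.mp (hKP i') (eK a).2)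
    · simp only [e, Sum.elim_inl, Sum.elim_inr] at h
      exact absurd (h ▸ (eP i b).2) (disjoint_left.mp (hKP i) (eK a').2)
    · simp only [e, Sum.elim_inr] at h
      have hi : i = i' := by
        by_contra hi
        exact disjoint_left.mp (hP hi) (eP i b).2 (h ▸ (eP i' b').2)
      subst hi
      simpa [Subtype.coe_inj] using h
  refine hf #K hKs ⟨e, he⟩ ?_
  simp only [badAssignments, mem_filter, mem_univ, true_and]
  refine ⟨y, fun i => ?_⟩
  rw [← (hU i).2, union_biUnion]
  congr 1
  · ext x
    simp only [columnUnion, mem_biUnion, mem_univ, true_and, Function.comp, e,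
      Function.Embedding.coeFn_mk, Sum.elim_inl]
    exact ⟨fun ⟨a, ha⟩ => ⟨_, (eK a).2, ha⟩, fun ⟨a, ha, hx⟩ => ⟨eK.symm ⟨a, ha⟩, by simpa using hx⟩⟩
  · ext x
    simp only [columnUnion, mem_biUnion, mem_univ, true_and, Function.comp, e,
      Function.Embedding.coeFn_mk, Sum.elim_inr]
    exact ⟨fun ⟨a, ha⟩ => ⟨_, (eP i a).2, ha⟩,
      fun ⟨a, ha, hx⟩ => ⟨(eP i).symm ⟨a, ha⟩, by simpa using hx⟩⟩

end GroupTesting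

/-! ### From the generating function to the lower rate -/

namespace GroupTesting

open Finset Filter Topology

/-- The exponent that the Chernoff bound with parameters `z` and `x` yields for petals of `l` columns
with union of relative weight `q` and a core of `k` columns, all columns of relative weight `w`. -/
noncomputable def chernoffExponent (l k : ℕ) (z x w q : ℝ) : ℝ :=
  l * h w - q * Real.logb 2 ((1 + z) ^ l - 1) + l * w * Real.logb 2 z -
    k * w * Real.logb 2 (1 + x) + q * Real.logb 2 x

theorem card_columnUnion_eq_le {N W l k Q : ℕ} (hN : 0 < N) (hl : 1 ≤ l) {u y : Finset (Fin N)}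
    (hu : #u ≤ k * W) {z x : ℝ} (hz : 0 < z) (hx : 0 < x) (hx1 : x ≤ 1) :
    (#{d : Fin l → Column N W | u ∪ columnUnion d = y ∧ #(columnUnion d) = Q} : ℝ) ≤
      2 ^ ((N : ℝ) * (l * h (W / N) - chernoffExponent l k z x (W / N) (Q / N))) := by
  classical
  have hN' : (0 : ℝ) < N := by exact_mod_cast hN
  set g := (1 + z) ^ l - 1 with hgdef
  have hg : 0 < g := sub_pos.mpr (one_lt_pow₀ (by linarith) (by omega))
  have h1 : #{d : Fin l → Column N W | u ∪ columnUnion d = y ∧ #(columnUnion d) = Q} ≤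
      #{c : Fin l → Finset (Fin N) | (∀ i, #(c i) = W) ∧ #(univ.biUnion c) = Q ∧
        u ∪ univ.biUnion c = y} := by
    refine card_le_card_of_injOn (fun d i => (d i).1) ?_ ?_
    · intro d hd
      simp only [coe_filter, mem_univ, true_and, Set.mem_ofPred_eq] at hd ⊢
      exact ⟨fun i => (d i).2, hd.2, hd.1⟩
    · intro d _ d' _ hdd
      funext i
      exact Subtype.ext (congrFun hdd i)
  have h2 := card_tuples_mul_le W Q hl u y hz hx hx1
  have hpos : 0 < z ^ (l * W) * (x / g) ^ Q := by positivity
  rw [← mul_le_mul_iff_left₀ hpos]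
  calc _ ≤ (1 + x) ^ #u := (mul_le_mul_of_nonneg_right (by exact_mod_cast h1) hpos.le).trans h2
    _ ≤ (1 + x) ^ (k * W) := pow_le_pow_right₀ (by linarith) hu
    _ = _ := by
      rw [← two_rpow_logb (x := (1 + x) ^ (k * W)) (by positivity), ← two_rpow_logb hpos,
        ← Real.rpow_add (by norm_num)]
      congr 1
      rw [Real.logb_mul (by positivity) (by positivity), Real.logb_pow, Real.logb_pow,
        Real.logb_pow, Real.logb_div (by positivity) (by positivity), chernoffExponent]
      push_cast
      field_simp
      ring

/-- The parameters `z`, `x` may depend on the size of the union. One factor `N + 1` counts these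
sizes; the other `l` come from replacing entropies by binomial coefficients. -/
theorem card_columnUnion_le_of_exponent {N W l k : ℕ} (hW : 0 < W) (hWN : W < N) (hl : 1 ≤ l)
    {u y : Finset (Fin N)} (hu : #u ≤ k * W) {β : ℝ}
    (hβ : ∀ q ∈ Set.Icc (0 : ℝ) 1, (W / N : ℝ) ≤ q → q ≤ l * (W / N : ℝ) →
      ∃ z x : ℝ, 0 < z ∧ 0 < x ∧ x ≤ 1 ∧ β ≤ chernoffExponent l k z x (W / N) q) :
    (#{d : Fin l → Column N W | u ∪ columnUnion d = y} : ℝ) ≤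
      (N + 1) ^ (l + 1) * 2 ^ (-((N : ℝ) * β)) * (N.choose W : ℝ) ^ l := by
  classical
  have hN : 0 < N := hW.trans hWN
  have hN' : (0 : ℝ) < N := by exact_mod_cast hN
  have hQ : ∀ Q ∈ range (N + 1),
      (#{d : Fin l → Column N W | u ∪ columnUnion d = y ∧ #(columnUnion d) = Q} : ℝ) ≤
        2 ^ ((N : ℝ) * (l * h (W / N) - β)) := by
    intro Q _
    rcases Finset.eq_empty_or_nonempty
      ({d : Fin l → Column N W | u ∪ columnUnion d = y ∧ #(columnUnion d) = Q} : Finset _)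
      with he | ⟨d, hd⟩
    · rw [he, card_empty, Nat.cast_zero]
      positivity
    · simp only [mem_filter, mem_univ, true_and] at hd
      have hQ1 : W ≤ Q := by
        rw [← hd.2]
        exact (d ⟨0, hl⟩).2.symm.trans_le
          (card_le_card (subset_biUnion_of_mem (fun i => (d i).1) (mem_univ _)))
      have hQ2 : Q ≤ l * W := by
        rw [← hd.2]
        exact (card_columnUnion_le d).trans (by simp)
      have hQ3 : Q ≤ N := by
        rw [← hd.2]
        exact (card_le_univ _).trans (by simp)
      have hQ1' : (W : ℝ) ≤ Q := by exact_mod_cast hQ1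
      have hQ2' : (Q : ℝ) ≤ l * W := by exact_mod_cast hQ2
      have hQ3' : (Q : ℝ) ≤ N := by exact_mod_cast hQ3
      obtain ⟨z, x, hz, hx, hx1, hle⟩ := hβ (Q / N) ⟨by positivity, by rwa [div_le_one hN']⟩
        (by gcongr) (by rw [← mul_div_assoc]; gcongr)
      refine (card_columnUnion_eq_le hN hl hu hz hx hx1).trans ?_
      gcongr
      · norm_num
  have hsum : (#{d : Fin l → Column N W | u ∪ columnUnion d = y} : ℝ) ≤
      (N + 1) * 2 ^ ((N : ℝ) * (l * h (W / N) - β)) := by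
    rw [card_eq_sum_card_fiberwise (f := fun d => #(columnUnion d)) (t := range (N + 1))]
    · push_cast
      refine (sum_le_card_nsmul _ _ (2 ^ ((N : ℝ) * (l * h (W / N) - β))) fun Q hQ' => ?_).trans
        (by simp)
      rw [filter_filter]
      exact hQ Q hQ'
    · intro d _
      have : #(columnUnion d) ≤ N := (card_le_univ _).trans (by simp)
      simpa [Nat.lt_succ_iff] using this
  refine hsum.trans ?_
  have hent := two_rpow_mul_h_le hW hWN
  calc (N + 1 : ℝ) * 2 ^ ((N : ℝ) * (l * h (W / N) - β))
      = (N + 1) * 2 ^ (-((N : ℝ) * β)) * (2 ^ ((N : ℝ) * h (W / N))) ^ l := by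
        rw [← Real.rpow_natCast, ← Real.rpow_mul (by norm_num), mul_assoc,
          ← Real.rpow_add (by norm_num)]
        congr 2
        ring
    _ ≤ (N + 1) * 2 ^ (-((N : ℝ) * β)) * ((N + 1) * N.choose W) ^ l := by gcongr
    _ = _ := by rw [mul_pow]; ring

/-- For `w < q < l * w` the right side is stationary in `z` at `z = (1 - y) / y`, with `y` the root
in the definition of `A`, and its value there is `A l w q + h q`. At the end points this value is
only a limit, as `z → ∞` for `q = w` and `z → 0` for `q = l * w`; hence the `ε`. -/
theorem exists_exponent_of_lt {l : ℕ} (hl : 1 ≤ l) {w q ε : ℝ} (hw : 0 < w) (hwq : w ≤ q)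
    (hql : q ≤ l * w) (hε : 0 < ε) :
    ∃ z : ℝ, 0 < z ∧ A l w q + h q - ε <
      l * h w - q * Real.logb 2 ((1 + z) ^ l - 1) + l * w * Real.logb 2 z := by
  have hl0 : l ≠ 0 := by omega
  have hq0 : 0 < q := hw.trans_le hwq
  by_cases h1 : q ≤ w
  · obtain rfl : q = w := le_antisymm h1 hwq
    rw [A, if_pos le_rfl]
    -- Here `a = 1 / z`, so that `z → ∞` becomes continuity at `0`.
    have hc : ContinuousAt (fun a : ℝ => q * Real.logb 2 ((1 + a) ^ l - a ^ l)) 0 := by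
      refine ContinuousAt.mul continuousAt_const (ContinuousAt.logb (by fun_prop) ?_)
      simp [hl0]
    have hev : ∀ᶠ a in 𝓝[>] (0 : ℝ), q * Real.logb 2 ((1 + a) ^ l - a ^ l) < ε := by
      refine (hc.eventually_lt_const ?_).filter_mono nhdsWithin_le_nhds
      simpa [hl0] using hε
    obtain ⟨a, ha, ha0⟩ := (hev.and self_mem_nhdsWithin).exists
    have ha0 : 0 < a := ha0
    refine ⟨a⁻¹, by positivity, ?_⟩
    have e : (1 + a⁻¹) ^ l - 1 = ((1 + a) ^ l - a ^ l) * a⁻¹ ^ l := by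
      rw [sub_mul, ← mul_pow, ← mul_pow, mul_inv_cancel₀ ha0.ne', one_pow,
        add_mul, mul_inv_cancel₀ ha0.ne', one_mul, add_comm]
    have hpos : 0 < (1 + a) ^ l - a ^ l :=
      sub_pos.mpr (pow_lt_pow_left₀ (by linarith) ha0.le hl0)
    rw [e, Real.logb_mul hpos.ne' (by positivity), Real.logb_pow]
    linarith
  have h1' : w < q := not_le.mp h1
  by_cases h2 : l * w ≤ q
  · obtain rfl : q = l * w := le_antisymm hql h2
    rw [A, if_neg h1, if_pos le_rfl]
    have hlpos : (0 : ℝ) < l := by exact_mod_cast hl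
    have hc : ContinuousAt (fun z : ℝ => l * w * Real.logb 2 (∑ i ∈ range l, (1 + z) ^ i)) 0 := by
      refine ContinuousAt.mul continuousAt_const (ContinuousAt.logb (by fun_prop) ?_)
      simp [hl0]
    have hev : ∀ᶠ z in 𝓝[>] (0 : ℝ),
        l * w * Real.logb 2 (∑ i ∈ range l, (1 + z) ^ i) < l * w * Real.logb 2 l + ε := by
      refine (hc.eventually_lt_const ?_).filter_mono nhdsWithin_le_nhds
      simpa using hε
    obtain ⟨z, hz, hz0⟩ := (hev.and self_mem_nhdsWithin).exists
    have hz0 : 0 < z := hz0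
    refine ⟨z, hz0, ?_⟩
    -- With the factor `z` split off, its logarithm cancels because `q = l * w`.
    have e : (1 + z) ^ l - 1 = (∑ i ∈ range l, (1 + z) ^ i) * z := by
      rw [← geom_sum_mul]; ring
    have hpos : 0 < ∑ i ∈ range l, (1 + z) ^ i :=
      sum_pos (fun i _ => by positivity) ⟨0, mem_range.mpr hl⟩
    have eh : h (l * w) = -(l * w) * (Real.logb 2 l + Real.logb 2 w) -
        (1 - l * w) * Real.logb 2 (1 - l * w) := by
      rw [← Real.logb_mul hlpos.ne' hw.ne', h]
    rw [e, Real.logb_mul hpos.ne' hz0.ne', eh]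
    linarith
  · have h2' : q < l * w := not_le.mp h2
    rw [A, if_neg h1, if_neg h2]
    have hex := (existsUnique_root l w q hw h1' h2').exists
    have hr : root l w q = hex.choose := dif_pos hex
    obtain ⟨⟨hy0, hy1⟩, hyq⟩ := hex.choose_spec
    rw [← hr] at hy0 hy1 hyq
    set y := root l w q
    have hy1' : 0 < 1 - y := by linarith
    have hyl : 0 < 1 - y ^ l := sub_pos.mpr (pow_lt_one₀ hy0.le hy1 hl0)
    refine ⟨(1 - y) / y, by positivity, ?_⟩
    have e1 : (1 + (1 - y) / y) ^ l - 1 = (1 - y ^ l) / y ^ l := by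
      rw [show 1 + (1 - y) / y = 1 / y by field_simp; ring, div_pow, one_pow]
      field_simp
    have e2 : w * y ^ l / (1 - y) = q * (y ^ l / (1 - y ^ l)) := by
      rw [hyq]; field_simp
    have eh : h q = -q * Real.logb 2 q - (1 - q) * Real.logb 2 (1 - q) := rfl
    simp only []
    rw [e1, e2, eh, Real.logb_mul hq0.ne' (by positivity), Real.logb_div hyl.ne' (by positivity),
      Real.logb_div (by positivity) hyl.ne']
    linarith

/-- The `x`-part `q * logb 2 x - k * w * logb 2 (1 + x)` is stationary at `x = p / (1 - p)` with `p
= q / (k * w)`, where it equals `-(k * w * h p)`. This `x` is admissible when `p ≤ 1 / 2`; for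
larger `q` the boundary value `x = 1` gives `-(k * w)`. -/
theorem exists_chernoffExponent_gt {s k : ℕ} (hk : k < s) {w q β : ℝ} (hw : 0 < w)
    (hwq : w ≤ q) (hql : q ≤ ((s - k : ℕ) : ℝ) * w) (hq1 : q ≤ 1)
    (hβ : ((β : ℝ) : EReal) < lowerRate s k w) :
    ∃ z x : ℝ, 0 < z ∧ 0 < x ∧ x ≤ 1 ∧ (s - k : ℕ) * β < chernoffExponent (s - k) k z x w q := by
  have hcast : ((s - k : ℕ) : ℝ) = s - k := Nat.cast_sub hk.le
  have hlpos : (0 : ℝ) < (s - k : ℕ) := by exact_mod_cast Nat.sub_pos_of_lt hk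
  have hl : 1 ≤ s - k := by omega
  have hq0 : 0 < q := hw.trans_le hwq
  obtain ⟨hβ1, hβ2⟩ := lt_min_iff.mp hβ
  suffices H : ∃ x : ℝ, 0 < x ∧ x ≤ 1 ∧
      (s - k : ℕ) * β < A (s - k) w q + h q - k * w * Real.logb 2 (1 + x) + q * Real.logb 2 x by
    obtain ⟨x, hx, hx1, hlt⟩ := H
    obtain ⟨z, hz, hz'⟩ := exists_exponent_of_lt hl hw hwq hql (sub_pos.mpr hlt)
    refine ⟨z, x, hz, hx, hx1, ?_⟩
    rw [chernoffExponent]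
    linarith
  rcases le_total (k * w / 2) q with hc | hc
  · refine ⟨1, one_pos, le_rfl, ?_⟩
    have := hβ1.trans_le (iInf₂_le q ⟨max_le hwq hc, le_min (hcast ▸ hql) hq1⟩)
    rw [EReal.coe_lt_coe_iff, ← hcast, lt_div_iff₀ hlpos] at this
    rw [show (1 : ℝ) + 1 = 2 by norm_num, Real.logb_self_eq_one (by norm_num), Real.logb_one]
    linarith
  · have := hβ2.trans_le (iInf₂_le q ⟨⟨hwq, hq1⟩, hcast ▸ hql, hc⟩)
    rw [EReal.coe_lt_coe_iff, ← hcast, lt_div_iff₀ hlpos] at this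
    have hkw : 0 < k * w := by linarith
    set p := q / (k * w) with hp
    have hp0 : 0 < p := by positivity
    have hp2 : p ≤ 1 / 2 := by rw [hp, div_le_iff₀ hkw]; linarith
    have hqp : q = k * w * p := by rw [mul_comm, hp, div_mul_cancel₀ q hkw.ne']
    have hp1 : 0 < 1 - p := by linarith
    refine ⟨p / (1 - p), by positivity, by rw [div_le_one hp1]; linarith, ?_⟩
    have e : 1 + p / (1 - p) = (1 - p)⁻¹ := by field_simp; ring
    rw [e, Real.logb_inv, Real.logb_div hp0.ne' hp1.ne']
    have e2 : -(k * w * -Real.logb 2 (1 - p)) + q * (Real.logb 2 p - Real.logb 2 (1 - p)) =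
        -(k * w * h p) := by
      rw [h, hqp]; ring
    linarith

/-- The true relative weight `⌊w * N⌋₊ / N` only tends to `w`. Parameters good at `(w, q)` stay good
nearby, since the exponent with fixed `z`, `x` is continuous there; compactness in `q` then gives
uniformity, with no continuity of `A` needed. -/
theorem eventually_exists_chernoffExponent_gt {s k : ℕ} (hk : k < s) {w β : ℝ} (hw : 0 < w)
    (hw1 : w < 1) (hβ : ((β : ℝ) : EReal) < lowerRate s k w) :
    ∀ᶠ w' in 𝓝 w, ∀ q ∈ Set.Icc (0 : ℝ) 1, w' ≤ q → q ≤ ((s - k : ℕ) : ℝ) * w' →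
      ∃ z x : ℝ, 0 < z ∧ 0 < x ∧ x ≤ 1 ∧
        (s - k : ℕ) * β ≤ chernoffExponent (s - k) k z x w' q := by
  refine isCompact_Icc.eventually_forall_of_forall_eventually fun q hq => ?_
  by_cases hwq : w ≤ q
  · by_cases hql : q ≤ ((s - k : ℕ) : ℝ) * w
    · obtain ⟨z, x, hz, hx, hx1, hlt⟩ := exists_chernoffExponent_gt hk hw hwq hql hq.2 hβ
      have hh : ContinuousAt h w := by
        unfold h
        refine ContinuousAt.sub (ContinuousAt.mul (by fun_prop)
          (ContinuousAt.logb (by fun_prop) hw.ne')) (ContinuousAt.mul (by fun_prop)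
          (ContinuousAt.logb (by fun_prop) (by linarith)))
      have hh' : ContinuousAt (fun p : ℝ × ℝ => h p.1) (w, q) :=
        ContinuousAt.comp (f := Prod.fst) (g := h) hh continuousAt_fst
      have hc : ContinuousAt (fun p : ℝ × ℝ => chernoffExponent (s - k) k z x p.1 p.2) (w, q) := by
        unfold chernoffExponent
        fun_prop
      filter_upwards [hc.eventually_const_lt hlt] with p hp _ _
      exact ⟨z, x, hz, hx, hx1, hp.le⟩
    -- Outside the closed range of `q` the constraints fail in a whole neighbourhood, so nothing is
    -- to be shown.
    · have hc : ContinuousAt (fun p : ℝ × ℝ => p.2 - ((s - k : ℕ) : ℝ) * p.1) (w, q) := by fun_prop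
      filter_upwards [hc.eventually_const_lt (show 0 < q - ((s - k : ℕ) : ℝ) * w by linarith)]
        with p hp _ hp'
      linarith
  · have hc : ContinuousAt (fun p : ℝ × ℝ => p.1 - p.2) (w, q) := by fun_prop
    filter_upwards [hc.eventually_const_lt (show 0 < w - q by linarith)] with p hp hp'
    linarith

end GroupTesting

/-! ### Asymptotics -/

namespace GroupTesting

open Finset Filter Topology

theorem tendsto_pow_mul_two_rpow_neg (p : ℕ) :
    Tendsto (fun N : ℕ => ((N : ℝ) + 1) ^ p * (2 : ℝ) ^ (-(N : ℝ))) atTop (𝓝 0) := by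
  have h1 : Tendsto (fun n : ℕ => (n : ℝ) ^ p / (2 : ℝ) ^ n) atTop (𝓝 0) :=
    tendsto_pow_const_div_const_pow_of_one_lt p (by norm_num)
  have h2 := ((tendsto_add_atTop_iff_nat 1).mpr h1).const_mul 2
  rw [mul_zero] at h2
  refine h2.congr fun N => ?_
  rw [Real.rpow_neg (by norm_num), Real.rpow_natCast, pow_succ]
  push_cast
  field_simp

/-- For rates `b < b'` below the exponent, long enough codes of rate `b` make the expected number of
bad sunflowers small, if the number `m` of petals is large. -/
theorem eventually_sum_expected_lt_one {s m : ℕ} {b b' : ℝ} (hb : 0 < b)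
    (hbb' : b < b') (hm : b * s + 2 ≤ m * (b' - b)) :
    ∀ᶠ N : ℕ in atTop, ∀ t : ℕ, (t : ℝ) ≤ 2 ^ (b * ((N : ℝ) + 1)) →
      ∑ k ∈ range s, (t : ℝ) ^ (k + m * (s - k)) *
        (2 ^ N * (((N : ℝ) + 1) ^ (s + 1) * 2 ^ (-((N : ℝ) * ((s - k : ℕ) * b')))) ^ m) < 1 := by
  have hlim := (tendsto_pow_mul_two_rpow_neg ((s + 1) * m)).const_mul
    ((s : ℝ) * 2 ^ (b * (s + m * s)))
  rw [mul_zero] at hlim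
  filter_upwards [hlim.eventually_lt_const one_pos] with N hN t ht
  refine lt_of_le_of_lt ?_ hN
  refine (sum_le_card_nsmul _ _ (2 ^ (b * (s + m * s)) *
    (((N : ℝ) + 1) ^ ((s + 1) * m) * 2 ^ (-(N : ℝ)))) fun k hk => ?_).trans_eq
    (by rw [card_range, nsmul_eq_mul, mul_assoc])
  have hk := mem_range.mp hk
  have hcast : ((s - k : ℕ) : ℝ) = s - k := Nat.cast_sub hk.le
  have hk' : (k : ℝ) + 1 ≤ s := by exact_mod_cast hk
  have hk0 : (0 : ℝ) ≤ k := Nat.cast_nonneg k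
  have hm0 : (0 : ℝ) ≤ m := Nat.cast_nonneg m
  have hN0 : (0 : ℝ) ≤ N := Nat.cast_nonneg N
  calc (t : ℝ) ^ (k + m * (s - k)) *
        (2 ^ N * (((N : ℝ) + 1) ^ (s + 1) * 2 ^ (-((N : ℝ) * ((s - k : ℕ) * b')))) ^ m)
      ≤ ((2 : ℝ) ^ (b * ((N : ℝ) + 1))) ^ (k + m * (s - k)) *
        (2 ^ N * (((N : ℝ) + 1) ^ (s + 1) * 2 ^ (-((N : ℝ) * ((s - k : ℕ) * b')))) ^ m) := by
        gcongr
    _ = ((N : ℝ) + 1) ^ ((s + 1) * m) * (2 : ℝ) ^ (b * ((N : ℝ) + 1) * (k + m * (s - k)) + N +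
          -((N : ℝ) * ((s - k) * b')) * m) := by
        rw [mul_pow, ← pow_mul, ← Real.rpow_natCast 2 N, ← Real.rpow_mul_natCast (by norm_num),
          ← Real.rpow_mul_natCast (by norm_num), Real.rpow_add (by norm_num),
          Real.rpow_add (by norm_num)]
        push_cast
        rw [hcast]
        ring
    _ ≤ ((N : ℝ) + 1) ^ ((s + 1) * m) * (2 : ℝ) ^ (b * (s + m * s) + -(N : ℝ)) := by
        refine mul_le_mul_of_nonneg_left
          (Real.rpow_le_rpow_of_exponent_le (by norm_num) ?_) (by positivity)
        have e1 : b * (k + m * (s - k)) ≤ b * (s + m * s) := by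
          have : (m : ℝ) * (s - k) ≤ m * s := by gcongr; linarith
          gcongr
        -- The coefficient of `N` in the exponent. Of the `2` in `hm`, one unit pays for the `2 ^ N`
        -- outcomes and the other leaves `2 ^ (-N)` to beat the polynomial factor.
        have e2 : b * k + 1 + m * (s - k) * (b - b') ≤ -1 := by
          have h1 : b * k ≤ b * s := by gcongr
          have h2 : m * (b' - b) * 1 ≤ m * (b' - b) * (s - k) := by
            have : 0 ≤ m * (b' - b) := mul_nonneg hm0 (by linarith)
            gcongr
            linarith
          linarith
        have e3 := mul_le_mul_of_nonneg_left e2 hN0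
        linarith
    _ = _ := by rw [Real.rpow_add (by norm_num)]; ring

theorem eventually_minTests_two_le {s : ℕ} {w b b' : ℝ} (hw : 0 < w) (hw1 : w < 1)
    (hb : 0 < b) (hbb' : b < b') (hlow : ∀ k < s, ((b' : ℝ) : EReal) < lowerRate s k w) :
    ∃ C : ℕ, ∀ᶠ N : ℕ in atTop, ∀ t : ℕ, (t : ℝ) ≤ 2 ^ (b * ((N : ℝ) + 1)) →
      minTests 2 t s ≤ N + C := by
  obtain ⟨m, hm⟩ := exists_nat_ge ((b * s + 2) / (b' - b))
  rw [div_le_iff₀ (by linarith)] at hm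
  have hm0 : 0 < m := by
    rcases Nat.eq_zero_or_pos m with rfl | h
    · have : 0 ≤ b * s := by positivity
      norm_num at hm
      linarith
    · exact h
  refine ⟨s * (s.factorial * m ^ s), ?_⟩
  have hweight : Tendsto (fun N : ℕ => ((⌊w * N⌋₊ : ℕ) : ℝ) / N) atTop (𝓝 w) :=
    (tendsto_nat_floor_mul_div_atTop hw.le).comp tendsto_natCast_atTop_atTop
  have hexp : ∀ᶠ N : ℕ in atTop, ∀ k ∈ range s, ∀ q ∈ Set.Icc (0 : ℝ) 1,
      ((⌊w * N⌋₊ : ℕ) : ℝ) / N ≤ q → q ≤ ((s - k : ℕ) : ℝ) * (((⌊w * N⌋₊ : ℕ) : ℝ) / N) →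
      ∃ z x : ℝ, 0 < z ∧ 0 < x ∧ x ≤ 1 ∧ (s - k : ℕ) * b' ≤
        chernoffExponent (s - k) k z x (((⌊w * N⌋₊ : ℕ) : ℝ) / N) q := by
    rw [eventually_all_finset]
    intro k hk
    have hk := mem_range.mp hk
    exact hweight.eventually (eventually_exists_chernoffExponent_gt hk hw hw1 (hlow k hk))
  filter_upwards [hexp, eventually_sum_expected_lt_one hb hbb' hm,
    hweight.eventually (eventually_gt_nhds hw), hweight.eventually (eventually_lt_nhds hw1),
    eventually_gt_atTop 0] with N hN1 hN2 hN3 hN4 hN5 t ht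
  have hN5' : (0 : ℝ) < N := by exact_mod_cast hN5
  generalize ⌊w * N⌋₊ = W at *
  have hW : 0 < W := by
    rw [div_pos_iff_of_pos_right hN5'] at hN3
    exact_mod_cast hN3
  have hWN : W < N := by
    rw [div_lt_one hN5'] at hN4
    exact_mod_cast hN4
  obtain ⟨f, hf⟩ := exists_code (t := t) (m := m) (Nat.choose_pos hWN.le)
    (fun k => ((N : ℝ) + 1) ^ (s + 1) * 2 ^ (-((N : ℝ) * ((s - k : ℕ) * b'))))
    (fun k hk u y hu => by
      refine (card_columnUnion_le_of_exponent hW hWN (by omega) hu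
        (hN1 k (mem_range.mpr hk))).trans ?_
      gcongr
      -- The base `N + 1` is at least `1`, so the exponent `s - k + 1` may be raised to `s + 1`, the
      -- same for all `k`.
      · linarith
      · omega)
    (fun k _ => by positivity) (hN2 t ht)
  exact minTests_two_le_of_code f hf hm0

/-- The gap between `b` and `b'` is spent on the random code; the gap between `a` and `b` absorbs
the constant cost `C` of the second stage. -/
theorem le_rate_two {s : ℕ} (hs : 1 ≤ s) {w a b b' : ℝ} (hw : 0 < w) (hw1 : w < 1) (ha : 0 < a)
    (hab : a < b) (hbb' : b < b') (hlow : ∀ k < s, ((b' : ℝ) : EReal) < lowerRate s k w) :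
    ((a : ℝ) : EReal) ≤ rate 2 s := by
  have hb : 0 < b := ha.trans hab
  obtain ⟨C, hC⟩ := eventually_minTests_two_le hw hw1 hb hbb' hlow
  have hlog : Tendsto (fun t : ℕ => Real.logb 2 t) atTop atTop :=
    (Real.tendsto_logb_atTop (by norm_num)).comp tendsto_natCast_atTop_atTop
  have hlen : Tendsto (fun t : ℕ => ⌊Real.logb 2 t / b⌋₊) atTop atTop :=
    tendsto_nat_floor_atTop.comp (hlog.atTop_div_const hb)
  refine le_liminf_of_le (by isBoundedDefault) ?_
  filter_upwards [hlen.eventually hC, eventually_gt_atTop s,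
    hlog.eventually_ge_atTop 0, hlog.eventually_ge_atTop (C / (1 / a - 1 / b))] with t h1 h2 h3 h4
  have ht : (0 : ℝ) < t := by exact_mod_cast (by omega : 0 < t)
  -- With `N = ⌊logb 2 t / b⌋₊` only `t ≤ 2 ^ (b * (N + 1))` is guaranteed, which explains the `N +
  -- 1` in the code lemmas.
  have hmin := h1 t (by
    rw [← two_rpow_logb ht]
    gcongr
    · norm_num
    · rw [two_rpow_logb ht, ← div_le_iff₀' hb]
      exact (Nat.lt_floor_add_one _).le)
  have hpos : (0 : ℝ) < minTests 2 t s := by exact_mod_cast minTests_pos hs h2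
  rw [EReal.coe_le_coe_iff, le_div_iff₀ hpos]
  have hmin' : (minTests 2 t s : ℝ) ≤ Real.logb 2 t / b + C := by
    have : (minTests 2 t s : ℝ) ≤ ⌊Real.logb 2 t / b⌋₊ + C := by exact_mod_cast hmin
    have := Nat.floor_le (show 0 ≤ Real.logb 2 t / b by positivity)
    linarith
  have hd : 0 < 1 / a - 1 / b := sub_pos.mpr (one_div_lt_one_div_of_lt ha hab)
  rw [div_le_iff₀ hd] at h4
  calc a * minTests 2 t s ≤ a * (Real.logb 2 t / b + C) := by gcongr
    _ ≤ a * (Real.logb 2 t / b + Real.logb 2 t * (1 / a - 1 / b)) := by gcongr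
    _ = Real.logb 2 t := by field_simp; ring

theorem rate_nonneg (p s : ℕ) : 0 ≤ rate p s := by
  refine le_liminf_of_le (by isBoundedDefault) ?_
  filter_upwards [eventually_ge_atTop 1] with t ht
  rw [← EReal.coe_zero, EReal.coe_le_coe_iff]
  have : 0 ≤ Real.logb 2 t := Real.logb_nonneg (by norm_num) (by exact_mod_cast ht)
  positivity

end GroupTesting

theorem theorem2 (s : ℕ) (hs : 1 ≤ s) :
    (⨆ w ∈ Set.Ioo (0 : ℝ) 1, ⨅ k ∈ Finset.range s, GroupTesting.lowerRate s k w) ≤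
      GroupTesting.rate 2 s := by
  refine le_of_forall_lt_imp_le_of_dense fun c hc => ?_
  obtain ⟨w, hc⟩ := lt_iSup_iff.mp hc
  obtain ⟨hw, hc⟩ := lt_iSup_iff.mp hc
  -- The code argument needs a positive rate; a bound `c ≤ 0` is trivial.
  rcases le_or_gt c 0 with hc0 | hc0
  · exact hc0.trans (GroupTesting.rate_nonneg 2 s)
  obtain ⟨a, hca, ha⟩ := EReal.lt_iff_exists_real_btwn.mp hc
  obtain ⟨b, hab, hb⟩ := EReal.lt_iff_exists_real_btwn.mp ha
  obtain ⟨b', hbb', hb'⟩ := EReal.lt_iff_exists_real_btwn.mp hb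
  have ha0 : 0 < a := by exact_mod_cast hc0.trans hca
  refine hca.le.trans (GroupTesting.le_rate_two hs hw.1 hw.2 ha0
    (EReal.coe_lt_coe_iff.mp hab) (EReal.coe_lt_coe_iff.mp hbb') fun k hk => ?_)
  exact hb'.trans_le (iInf₂_le k (Finset.mem_range.mpr hk))
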